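/- Let $p$ be a prime, let $q$ be a power of $p$, let $m\ge 1$ with $\gcd(q-1,m)=1$, and put $r=q^m$. Let $g$ be a generator of $\mathbb{F}_{r}^*$, let $\alpha=g^{q-1}$, and let $\mathrm{Tr}$ denote the trace from $\mathbb{F}_{q^m}$ to $\mathbb{F}_q$. Consider the Singer-type difference set $$D=\left\{0\le t<\tfrac{q^m-1}{q-1} : \mathrm{Tr}(\alpha^t)=0\right\}\subset \mathbb{Z}_{(q^m-1)/(q-1)}.$$ Write $\frac{q^m-1}{q-1}=n\ell$ with integers $n>1$ and $\ell\ge 2$, and for $0\le i<\ell$ let $$D_i=\{0\le x\le n-1 : \mathrm{Tr}(\alpha^{\ell x+i})=0\}=\{0\le x\le n-1 : \ell x+i\in D\},\qquad k_i=|D_i|.$$ Suppose that $\ell\mid p^j+1$ for some positive integer $j$, that $j$ is the smallest such positive integer, and that $r=p^{2j\gamma}$ for a positive integer $\gamma$. Then the intersection numbers $k_0,\dots,k_{\ell-1}$ are as follows. **Case A.** If $\gamma$, $p$ and $\frac{p^j+1}{\ell}$ are all odd, then exactly one $i'\in\{0,\dots,\ell-1\}$ satisfies $i'(q-1)\equiv\frac{\ell}{2}\pmod{\ell}$,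 and $$k_{i'}=\frac{r-1+\big((\ell-1)\sqrt r-1\big)(q-1)}{\ell(q-1)q},\qquad k_i=\frac{(r-1)-(1+\sqrt r)(q-1)}{\ell(q-1)q}\quad\text{for all } 0\le i<\ell,\ i\ne i'.$$ **Case B.** In all other cases, $$k_0=\frac{r-1-(q-1)\big[(-1)^\gamma(\ell-1)\sqrt r+1\big]}{\ell(q-1)q},\qquad k_i=\frac{r-1+(q-1)\big[(-1)^\gamma\sqrt r-1\big]}{\ell(q-1)q}\quad\text{for all } 0<i<\ell.$$ (Under these hypotheses $\ell$ is always odd, so Case A does not actually occur; it is stated for completeness.) -/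

import Mathlib

/-- The set `D_b^{(m,q)} = {0 ≤ i < (q^m - 1)/(q - 1) : Tr_{K/F}(α^i) = b}`, where `α = g^(q-1)`,
`F` is the field with `q` elements, `K` is its extension of degree `m`, and `g` is meant to be
a generator of `Kˣ`. The trace-zero Singer-type difference set is the case `b = 0`. -/
noncomputable def singerSet (F : Type*) {K : Type*} [Field F] [Field K] [Algebra F K]
    (g : Kˣ) (b : F) : Finset ℕ :=
  open Classical in
  (Finset.range ((Nat.card F ^ Module.finrank F K - 1) / (Nat.card F - 1))).filter
    (fun i => Algebra.trace F K (((g : K) ^ (Nat.card F - 1)) ^ i) = b)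

/-- The base block `D_i = {0 ≤ x ≤ n - 1 : Tr_{K/F}(α^(ℓ x + i)) = 0}`, where `α = g^(q-1)`. -/
noncomputable def baseBlock (F : Type*) {K : Type*} [Field F] [Field K] [Algebra F K]
    (g : Kˣ) (n ℓ i : ℕ) : Finset ℕ :=
  open Classical in
  (Finset.range n).filter
    (fun x => Algebra.trace F K (((g : K) ^ (Nat.card F - 1)) ^ (ℓ * x + i)) = 0)

/-- For `0 ≤ i < ℓ` and `n ℓ = (q^m - 1)/(q - 1)`, the block `D_i` is the part of the difference
set `D = D_0^{(m,q)}` in the coset of `i` modulo `ℓ`, translated by `-i` and divided by `ℓ`. -/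
theorem mem_baseBlock_iff {F K : Type*} [Field F] [Field K] [Algebra F K]
    (g : Kˣ) (n ℓ i : ℕ)
    (hv : (Nat.card F ^ Module.finrank F K - 1) / (Nat.card F - 1) = n * ℓ) (hi : i < ℓ)
    (x : ℕ) : x ∈ baseBlock F g n ℓ i ↔ ℓ * x + i ∈ singerSet F g 0 := by
  have h : x < n ↔ ℓ * x + i < n * ℓ := by
    constructor
    · intro hx
      nlinarith
    · intro hx
      by_contra hc
      nlinarith [Nat.mul_le_mul_left ℓ (not_lt.mp hc)]
  simp only [baseBlock, singerSet, Finset.mem_filter, Finset.mem_range, hv, h]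

/-- The intersection number `k_i = |D_i|`. -/
noncomputable def intersectionNumber (F : Type*) {K : Type*} [Field F] [Field K] [Algebra F K]
    (g : Kˣ) (n ℓ i : ℕ) : ℕ :=
  (baseBlock F g n ℓ i).card

/-! ### Sums of periodic functions and sums over cyclic groups -/

/-! Orthogonality of the characters of `F` turns each intersection number into a power sum `∑ χ(a
x^ℓ)` over `Kˣ` with `a = α^i`. Coprimality of `q - 1` and `ℓ` makes every nonzero scalar an `ℓ`-th
power, so scalars are absorbed into `x`.

To evaluate the power sum, put `Q = p^j`, so that `ℓ ∣ Q + 1`, and first take exponent `Q + 1`. The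
trace of `b x^(Q+1)` is then a quadratic form over the prime field; its radical is trivial when `b`
is not an `ℓ`-th power, so the full sum `S` over `K` squares to `|K| = Q^(2γ)`
(`sq_sum_addChar_mul_pow`). The sign follows from `S ≡ 1` modulo `Q + 1` in the algebraic integers
(`eq_neg_pow_of_sq_eq`). Averaging over `b = a y^ℓ` passes to exponent `ℓ`
(`sum_units_pow_of_not_pow`), and the one remaining class, that of the `ℓ`-th powers, is forced by
the total over all `a` (`sum_units_pow_one`). -/

theorem sum_range_mul_of_periodic {M : Type*} [AddCommMonoid M] {f : ℕ → M} {n : ℕ}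
    (hf : Function.Periodic f n) (k : ℕ) :
    ∑ t ∈ Finset.range (n * k), f t = k • ∑ t ∈ Finset.range n, f t := by
  induction k with
  | zero => simp
  | succ k ih =>
    rw [Nat.mul_succ, Finset.sum_range_add, ih, succ_nsmul]
    congr 1
    refine Finset.sum_congr rfl fun t _ => ?_
    rw [add_comm, mul_comm]
    exact hf.nat_mul k t

theorem sum_range_coprime_mul_of_periodic {M : Type*} [AddCommMonoid M] {f : ℕ → M} {n c : ℕ}
    (hn : 0 < n) (hf : Function.Periodic f n) (hc : n.Coprime c) :
    ∑ t ∈ Finset.range n, f (c * t) = ∑ t ∈ Finset.range n, f t := by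
  have hmaps : Set.MapsTo (fun t => c * t % n) (Finset.range n) (Finset.range n) :=
    fun t _ => by simpa using Nat.mod_lt _ hn
  have hinj : Set.InjOn (fun t => c * t % n) (Finset.range n) := by
    intro s hs t ht hst
    simp only [Finset.coe_range, Set.mem_Iio] at hs ht
    have h : s ≡ t [MOD n] := Nat.ModEq.cancel_left_of_coprime hc hst
    rwa [Nat.ModEq, Nat.mod_eq_of_lt hs, Nat.mod_eq_of_lt ht] at h
  refine Finset.sum_nbij (fun t => c * t % n) hmaps hinj
    (Finset.surjOn_of_injOn_of_card_le _ hmaps hinj le_rfl) fun t _ => ?_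
  exact (hf.map_mod_nat _).symm

theorem sum_eq_sum_range_generator {G M : Type*} [Group G] [Fintype G] [AddCommMonoid M] {g : G}
    (hg : ∀ x, x ∈ Subgroup.zpowers g) (f : G → M) :
    ∑ x, f x = ∑ t ∈ Finset.range (Nat.card G), f (g ^ t) := by
  classical
  rw [← IsCyclic.image_range_card hg, Finset.sum_image]
  rw [← orderOf_eq_card_of_forall_mem_zpowers hg]
  intro s hs t ht hst
  exact pow_injOn_Iio_orderOf (by simpa using hs) (by simpa using ht) hst

theorem sum_eq_zero_add_sum_units {K M : Type*} [Field K] [Fintype K] [Fintype Kˣ]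
    [AddCommMonoid M] (f : K → M) : ∑ x, f x = f 0 + ∑ u : Kˣ, f u := by
  classical
  rw [← Finset.add_sum_erase Finset.univ f (Finset.mem_univ 0)]
  congr 1
  symm
  refine Finset.sum_nbij (fun u : Kˣ => (u : K)) (by simp) (fun _ _ _ _ h => Units.ext h) ?_
    (fun _ _ => rfl)
  intro x hx
  exact ⟨Units.mk0 x (by simpa using hx), by simp, rfl⟩

/-! ### Characters built from the trace to the prime field -/

theorem isPrimitive_stdAddChar_comp_trace (p : ℕ) [Fact p.Prime] (L : Type*) [Field L] [Finite L]
    [Algebra (ZMod p) L] :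
    ((ZMod.stdAddChar (N := p)).compAddMonoidHom
      (Algebra.trace (ZMod p) L).toAddMonoidHom).IsPrimitive := by
  refine AddChar.IsPrimitive.of_ne_one fun h => ?_
  have hstd := ZMod.isPrimitive_stdAddChar p one_ne_zero
  rw [AddChar.mulShift_one, AddChar.ne_one_iff] at hstd
  obtain ⟨y, hy⟩ := hstd
  obtain ⟨x, rfl⟩ := Algebra.trace_surjective (ZMod p) L y
  exact hy (by simpa using DFunLike.congr_fun h x)

/-- Both characters factor through the absolute trace: transitivity of the trace relates them, and
its Galois invariance makes `χ` constant on Frobenius orbits. -/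
theorem exists_primitive_addChar_trace (F K : Type*) [Field F] [Finite F] [Field K] [Finite K]
    [Algebra F K] (p : ℕ) [Fact p.Prime] [CharP F p] :
    ∃ (ψ : AddChar F ℂ) (χ : AddChar K ℂ), ψ.IsPrimitive ∧ χ.IsPrimitive ∧
      (∀ x, χ (x ^ p) = χ x) ∧ ∀ x, χ x = ψ (Algebra.trace F K x) := by
  have : CharP K p := charP_of_injective_algebraMap' F p
  let : Algebra (ZMod p) F := ZMod.algebra F p
  let : Algebra (ZMod p) K := ZMod.algebra K p
  have : IsScalarTower (ZMod p) F K := IsScalarTower.of_algebraMap_eq' (Subsingleton.elim _ _)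
  refine ⟨_, _, isPrimitive_stdAddChar_comp_trace p F, isPrimitive_stdAddChar_comp_trace p K,
    fun x => ?_, fun x => ?_⟩
  · have h := Algebra.trace_eq_of_algEquiv
      (FiniteField.frobeniusAlgEquivOfAlgebraic (ZMod p) K) x
    rw [FiniteField.coe_frobeniusAlgEquivOfAlgebraic, ZMod.card] at h
    simp [h]
  · simp [Algebra.trace_trace]

/-! ### Power sums of additive characters -/

/-- Since `-1` is a `(p^j + 1)`-th power, the sum equals its conjugate, so its square is a
Weyl-differenced double sum; `hb` says that the radical is trivial, and only the zero shift
survives. -/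
theorem sq_sum_addChar_mul_pow {K : Type*} [Field K] [Fintype K] (p : ℕ)
    [Fact p.Prime] [CharP K p] {χ : AddChar K ℂ} (hχ : χ.IsPrimitive)
    (hfr : ∀ x, χ (x ^ p) = χ x) (j : ℕ) {b : K} (hneg : ∃ z : K, z ^ (p ^ j + 1) = -1)
    (hb : ∀ y, b * y + (b * y ^ p ^ j) ^ p ^ j = 0 → y = 0) :
    (∑ x, χ (b * x ^ (p ^ j + 1))) ^ 2 = Fintype.card K := by
  classical
  obtain ⟨z, hz⟩ := hneg
  have hz0 : z ≠ 0 := by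
    rintro rfl
    simp at hz
  have hfrj : ∀ (i : ℕ) (x : K), χ (x ^ p ^ i) = χ x := by
    intro i
    induction i with
    | zero => simp
    | succ i ih => intro x; rw [pow_succ, pow_mul, hfr, ih]
  have hS : ∑ x, χ (b * x ^ (p ^ j + 1)) = ∑ y, χ (-(b * y ^ (p ^ j + 1))) := by
    rw [← Equiv.sum_comp (Equiv.mulLeft₀ z hz0)]
    simp [mul_pow, hz]
  have hbij : Function.Bijective (iterateFrobenius K p j) :=
    Finite.injective_iff_bijective.mp (iterateFrobenius_inj K p j)
  have hinner : ∀ y : K, ∑ x, χ (b * (y + x) ^ (p ^ j + 1)) * χ (-(b * x ^ (p ^ j + 1))) =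
      χ (b * y ^ (p ^ j + 1)) * if y = 0 then (Fintype.card K : ℂ) else 0 := by
    intro y
    have hterm : ∀ x : K, χ (b * (y + x) ^ (p ^ j + 1)) * χ (-(b * x ^ (p ^ j + 1))) =
        χ (b * y ^ (p ^ j + 1)) *
          χ (iterateFrobenius K p j x * (b * y + (b * y ^ p ^ j) ^ p ^ j)) := by
      intro x
      have h1 : b * (y + x) ^ (p ^ j + 1) + -(b * x ^ (p ^ j + 1)) =
          b * y ^ (p ^ j + 1) + (b * y * x ^ p ^ j + b * y ^ p ^ j * x) := by
        rw [pow_succ, add_pow_char_pow]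
        ring
      -- Frobenius invariance raises the second cross term to the power `p^j`, so that both become
      -- multiples of `x^(p^j)`.
      rw [← AddChar.map_add_eq_mul, h1, AddChar.map_add_eq_mul, AddChar.map_add_eq_mul χ (b * y * _),
        ← hfrj j (b * y ^ p ^ j * x), ← AddChar.map_add_eq_mul χ (b * y * _), iterateFrobenius_def]
      congr 2
      ring
    rw [Finset.sum_congr rfl fun x _ => hterm x, ← Finset.mul_sum,
      hbij.sum_comp fun u => χ (u * (b * y + (b * y ^ p ^ j) ^ p ^ j)), AddChar.sum_mulShift _ hχ]
    congr 1
    by_cases hy : y = 0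
    · simp [hy, (Fact.out : p.Prime).ne_zero]
    · rw [if_neg hy, if_neg fun h => hy (hb y h), Nat.cast_zero]
  calc (∑ x, χ (b * x ^ (p ^ j + 1))) ^ 2
      = (∑ x, χ (b * x ^ (p ^ j + 1))) * ∑ y, χ (-(b * y ^ (p ^ j + 1))) := by rw [sq, ← hS]
    _ = ∑ x, ∑ y, χ (b * (y + x) ^ (p ^ j + 1)) * χ (-(b * x ^ (p ^ j + 1))) := by
        rw [Finset.sum_mul_sum, Finset.sum_comm]
        refine Finset.sum_congr rfl fun x _ => ?_
        exact (Equiv.sum_comp (Equiv.addRight x)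
          fun y => χ (b * y ^ (p ^ j + 1)) * χ (-(b * x ^ (p ^ j + 1)))).symm
    _ = Fintype.card K := by
        rw [Finset.sum_comm, Finset.sum_congr rfl fun y _ => hinner y]
        simp

/-- Here `S = ±Q^γ` makes `η` rational, hence an integer. As `Q ≡ -1` modulo `Q + 1`, the congruence
`S ≡ 1` fixes the sign, because `Q + 1 ≥ 3` does not divide `2`. -/
theorem eq_neg_pow_of_sq_eq {Q γ : ℕ} (hQ : 2 ≤ Q) {S η : ℂ} (hη : IsIntegral ℤ η)
    (hS : S ^ 2 = ((Q : ℂ) ^ γ) ^ 2) (hSη : S = 1 + ((Q : ℂ) + 1) * η) :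
    S = (-1) ^ γ * (Q : ℂ) ^ γ := by
  obtain ⟨ε, hε, hSε⟩ : ∃ ε : ℤ, (ε = 1 ∨ ε = -1) ∧ S = ε * (Q : ℂ) ^ γ := by
    rcases sq_eq_sq_iff_eq_or_eq_neg.mp hS with h | h
    · exact ⟨1, Or.inl rfl, by simp [h]⟩
    · exact ⟨-1, Or.inr rfl, by simp [h]⟩
  have hQ0 : ((Q : ℂ) + 1) ≠ 0 := by exact_mod_cast Nat.succ_ne_zero Q
  have hrat : η = algebraMap ℚ ℂ ((ε * (Q : ℚ) ^ γ - 1) / (Q + 1)) := by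
    have : η = (S - 1) / (Q + 1) := by rw [hSη]; field_simp; ring
    rw [this, hSε]
    simp
  rw [hrat, isIntegral_algebraMap_iff (algebraMap ℚ ℂ).injective] at hη
  obtain ⟨k, hk⟩ := IsIntegrallyClosed.isIntegral_iff.mp hη
  have hk' : (ε * (Q : ℤ) ^ γ - 1) = k * (Q + 1) := by
    have hQ1 : ((Q : ℚ) + 1) ≠ 0 := by exact_mod_cast Nat.succ_ne_zero Q
    rw [eq_div_iff hQ1] at hk
    rw [eq_intCast] at hk
    exact_mod_cast hk.symm
  have hmod : (Q : ℤ) ^ γ ≡ (-1) ^ γ [ZMOD (Q + 1)] := by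
    refine Int.ModEq.pow _ (Int.modEq_iff_dvd.mpr ⟨-1, by ring⟩)
  have hd : ((Q : ℤ) + 1) ∣ ε * (-1) ^ γ - 1 := by
    have h1 := (hmod.mul_left ε).dvd
    have h2 : ((Q : ℤ) + 1) ∣ ε * (Q : ℤ) ^ γ - 1 := ⟨k, by rw [hk']; ring⟩
    simpa using dvd_add h1 h2
  have hεγ : ε = (-1) ^ γ := by
    have hne : ¬ ((Q : ℤ) + 1) ∣ -2 := fun h => by
      have := Int.le_of_dvd (by norm_num) ((dvd_neg.mpr h : ((Q : ℤ) + 1) ∣ - -2))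
      omega
    rcases hε with rfl | rfl <;> rcases neg_one_pow_eq_or ℤ γ with h | h <;> rw [h] at hd ⊢ <;>
      norm_num at hd hne <;> exact absurd hd hne
  rw [hSε, hεγ]
  simp

theorem exists_pow_eq_of_pow_eq_one {G : Type*} [Group G] [Finite G] {g : G}
    (hg : ∀ x, x ∈ Subgroup.zpowers g) {d n : ℕ} (hd : 0 < d) (hcard : d * n ∣ Nat.card G) {x : G}
    (hx : x ^ d = 1) : ∃ z, z ^ n = x := by
  obtain ⟨e, rfl⟩ := (Submonoid.mem_powers_iff _ _).mp
    ((mem_powers_iff_mem_zpowers).mpr (hg x))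
  rw [← pow_mul, ← orderOf_dvd_iff_pow_eq_one, orderOf_eq_card_of_forall_mem_zpowers hg,
    mul_comm e] at hx
  obtain ⟨c, rfl⟩ := (Nat.mul_dvd_mul_iff_left hd).mp (hcard.trans hx)
  exact ⟨g ^ c, by rw [← pow_mul, mul_comm]⟩

theorem isIntegral_addChar_apply {K : Type*} [Field K] (p : ℕ) [Fact p.Prime] [CharP K p]
    (χ : AddChar K ℂ) (x : K) : IsIntegral ℤ (χ x) := by
  refine IsIntegral.of_pow (Fact.out : p.Prime).pos ?_
  rw [← AddChar.map_nsmul_eq_pow, nsmul_eq_mul, CharP.cast_eq_zero, zero_mul,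
    AddChar.map_zero_eq_one]
  exact isIntegral_one

/-- If `n` divides `|Kˣ|`, a sum over `n`-th powers is `n` times a Gaussian period. -/
theorem exists_isIntegral_sum_units_pow {K : Type*} [Field K] [Finite K] [Fintype Kˣ] (p : ℕ)
    [Fact p.Prime] [CharP K p] (χ : AddChar K ℂ) {n : ℕ} (hn : n ∣ Nat.card Kˣ) (b : K) :
    ∃ η : ℂ, IsIntegral ℤ η ∧ ∑ x : Kˣ, χ (b * (x : K) ^ n) = n * η := by
  obtain ⟨g, hg⟩ := IsCyclic.exists_generator (α := Kˣ)
  obtain ⟨M, hM⟩ := hn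
  have hper : Function.Periodic (fun t => χ (b * ((g ^ t : Kˣ) : K) ^ n)) M := by
    intro t
    have : (g ^ M) ^ n = 1 := by rw [← pow_mul, mul_comm, ← hM, pow_card_eq_one']
    simp only [← Units.val_pow_eq_pow_val]
    rw [pow_add, mul_pow, this, mul_one]
  refine ⟨∑ t ∈ Finset.range M, χ (b * ((g ^ t : Kˣ) : K) ^ n),
    IsIntegral.sum _ fun t _ => isIntegral_addChar_apply p χ _, ?_⟩
  rw [sum_eq_sum_range_generator hg, hM, mul_comm n M, sum_range_mul_of_periodic hper,
    nsmul_eq_mul]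

/-- The semiprimitive case: power sums at elements that are not `ℓ`-th powers. -/
theorem sum_units_pow_succ_of_not_pow {K : Type*} [Field K] [Fintype K] [Fintype Kˣ] (p : ℕ)
    [Fact p.Prime] [CharP K p] {χ : AddChar K ℂ} (hχ : χ.IsPrimitive)
    (hfr : ∀ x, χ (x ^ p) = χ x) {j γ ℓ k M c : ℕ} (hj : 0 < j) (hodd : Odd ℓ)
    (hcard : Nat.card K = (p ^ j) ^ (2 * γ)) (hk : p ^ j + 1 = ℓ * k)
    (hM : Nat.card Kˣ = ℓ * M) (hc : M = (p ^ j - 1) * c) (hck : k ∣ c)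
    {b : Kˣ} (hb : b ^ M ≠ 1) :
    ∑ x : Kˣ, χ ((b : K) * (x : K) ^ (p ^ j + 1)) = (-1) ^ γ * ((p : ℂ) ^ j) ^ γ - 1 := by
  have hp : p.Prime := Fact.out
  have hQ : 2 ≤ p ^ j := hp.two_le.trans (Nat.le_self_pow hj.ne' p)
  obtain ⟨d, rfl⟩ := hck
  have hdvd : (p ^ j - 1) * (p ^ j + 1) ∣ Nat.card Kˣ := ⟨d, by rw [hM, hc, hk]; ring⟩
  have hroot : ∀ x : Kˣ, (x : K) ^ p ^ j = -x → (x : K) ^ (p ^ j - 1) = -1 := by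
    intro x hx
    refine mul_right_cancel₀ x.ne_zero ?_
    rw [← pow_succ, Nat.sub_add_cancel (by lia), hx, neg_one_mul]
  have hneg : ∃ z : K, z ^ (p ^ j + 1) = -1 := by
    obtain ⟨g, hg⟩ := IsCyclic.exists_generator (α := Kˣ)
    -- Deduced from `(-1)^(p^j) = -1`, which also covers `p = 2`.
    have h1 : (-1 : Kˣ) ^ (p ^ j - 1) = 1 := by
      have h : (-1 : Kˣ) ^ p ^ j = -1 := Units.ext (by simpa using neg_one_pow_char_pow K p j)
      rw [← mul_left_inj (-1 : Kˣ), ← pow_succ, Nat.sub_add_cancel (by lia), h, one_mul]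
    obtain ⟨z, hz⟩ := exists_pow_eq_of_pow_eq_one hg (by lia) hdvd h1
    exact ⟨z, by rw [← Units.val_pow_eq_pow_val, hz]; simp⟩
  have hrad : ∀ y : K, (b : K) * y + (b * y ^ p ^ j) ^ p ^ j = 0 → y = 0 := by
    intro y hy
    by_contra hy0
    -- A nonzero radical vector gives `w^(p^j - 1) = -1`, so `w^M = ±1`. As `w^M` is also an `ℓ`-th
    -- root of unity with `ℓ` odd, it is `1`, and `b` would be an `ℓ`-th power.
    set w : Kˣ := b * Units.mk0 y hy0 ^ (p ^ j + 1) with hw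
    have hwQ : (w : K) ^ p ^ j = -w := by
      have hwval : (w : K) = b * y ^ (p ^ j + 1) := by simp [hw]
      rw [eq_neg_iff_add_eq_zero, hwval]
      calc _ = y ^ p ^ j * ((b : K) * y + (b * y ^ p ^ j) ^ p ^ j) := by ring
        _ = 0 := by rw [hy, mul_zero]
    have hw2 : (w ^ M) ^ 2 = 1 := by
      have : w ^ (p ^ j - 1) = -1 := Units.ext (by simpa using hroot w hwQ)
      rw [hc, pow_mul, this, ← pow_mul, mul_comm, pow_mul]
      simp
    have hwℓ : (w ^ M) ^ ℓ = 1 := by rw [← pow_mul, mul_comm, ← hM, pow_card_eq_one']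
    have hwM : w ^ M = 1 := by
      obtain ⟨t, rfl⟩ := hodd
      rwa [pow_succ, pow_mul, hw2, one_pow, one_mul] at hwℓ
    apply hb
    rw [hw, mul_pow, ← pow_mul, hk, mul_right_comm, ← hM, pow_mul, pow_card_eq_one', one_pow,
      mul_one] at hwM
    exact hwM
  have hsq := sq_sum_addChar_mul_pow p hχ hfr j hneg hrad
  obtain ⟨η, hη, hsum⟩ := exists_isIntegral_sum_units_pow p χ (n := p ^ j + 1)
    (dvd_of_mul_left_dvd hdvd) (b : K)
  have hS := sum_eq_zero_add_sum_units fun x : K => χ ((b : K) * x ^ (p ^ j + 1))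
  simp only [zero_pow (Nat.succ_ne_zero _), mul_zero, AddChar.map_zero_eq_one] at hS
  have h := eq_neg_pow_of_sq_eq (γ := γ) hQ hη (S := ∑ x : K, χ ((b : K) * x ^ (p ^ j + 1)))
    (by rw [hsq, ← Nat.card_eq_fintype_card, hcard]; push_cast; ring)
    (by rw [hS, hsum]; push_cast; ring)
  rw [hS] at h
  push_cast at h
  rw [← h]
  ring

/-- Sum `χ(a y^ℓ x^(p^j + 1))` over `x` and `y` in both orders: `a y^ℓ` is still not an `ℓ`-th
power, while `x^(p^j + 1) = (x^k)^ℓ` is absorbed into `y`. -/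
theorem sum_units_pow_of_not_pow {K : Type*} [Field K] [Fintype K] [Fintype Kˣ] (p : ℕ)
    [Fact p.Prime] [CharP K p] {χ : AddChar K ℂ} (hχ : χ.IsPrimitive)
    (hfr : ∀ x, χ (x ^ p) = χ x) {j γ ℓ k M c : ℕ} (hj : 0 < j) (hodd : Odd ℓ)
    (hcard : Nat.card K = (p ^ j) ^ (2 * γ)) (hk : p ^ j + 1 = ℓ * k)
    (hM : Nat.card Kˣ = ℓ * M) (hc : M = (p ^ j - 1) * c) (hck : k ∣ c)
    {a : Kˣ} (ha : a ^ M ≠ 1) :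
    ∑ x : Kˣ, χ ((a : K) * (x : K) ^ ℓ) = (-1) ^ γ * ((p : ℂ) ^ j) ^ γ - 1 := by
  have h1 : ∀ y : Kˣ, ∑ x : Kˣ, χ ((a : K) * (y : K) ^ ℓ * (x : K) ^ (p ^ j + 1)) =
      (-1) ^ γ * ((p : ℂ) ^ j) ^ γ - 1 := by
    intro y
    have := sum_units_pow_succ_of_not_pow p hχ hfr hj hodd hcard hk hM hc hck (b := a * y ^ ℓ)
      (by rwa [mul_pow, ← pow_mul, ← hM, pow_card_eq_one', mul_one])
    simpa using this
  have h2 : ∀ x : Kˣ, ∑ y : Kˣ, χ ((a : K) * (y : K) ^ ℓ * (x : K) ^ (p ^ j + 1)) =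
      ∑ y : Kˣ, χ ((a : K) * (y : K) ^ ℓ) := by
    intro x
    rw [← Equiv.sum_comp (Equiv.mulRight (x ^ k)) fun y : Kˣ => χ ((a : K) * (y : K) ^ ℓ)]
    refine Finset.sum_congr rfl fun y _ => ?_
    simp only [Equiv.coe_mulRight, Units.val_mul, Units.val_pow_eq_pow_val]
    rw [hk, mul_pow, ← pow_mul, mul_comm k ℓ, mul_assoc]
  have h3 := Finset.sum_comm (s := Finset.univ) (t := Finset.univ)
    (f := fun x y : Kˣ => χ ((a : K) * (y : K) ^ ℓ * (x : K) ^ (p ^ j + 1)))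
  simp only [h1, h2, Finset.sum_const, nsmul_eq_mul] at h3
  exact mul_left_cancel₀ (by simp) h3

/-- The power sum at `1`, given its common value at the elements that are not `ℓ`-th powers. -/
theorem sum_units_pow_one {K : Type*} [Field K] [Fintype K] [Fintype Kˣ]
    {χ : AddChar K ℂ} (hχ : χ.IsPrimitive) {g : Kˣ} (hg : ∀ x, x ∈ Subgroup.zpowers g)
    {ℓ M : ℕ} (hℓ : 0 < ℓ) (hM : Nat.card Kˣ = ℓ * M) {E : ℂ}
    (hE : ∀ a : Kˣ, a ^ M ≠ 1 → ∑ x : Kˣ, χ ((a : K) * (x : K) ^ ℓ) = E) :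
    ∑ x : Kˣ, χ ((x : K) ^ ℓ) = -ℓ - (ℓ - 1) * E := by
  classical
  have hMpos : 0 < M := Nat.pos_of_ne_zero fun h => by simp [h] at hM
  have horder : orderOf g = ℓ * M := by rw [orderOf_eq_card_of_forall_mem_zpowers hg, hM]
  have hper : Function.Periodic
      (fun t => ∑ x : Kˣ, χ (((g ^ t : Kˣ) : K) * (x : K) ^ ℓ)) ℓ := by
    intro t
    beta_reduce
    rw [← Equiv.sum_comp (Equiv.mulLeft g) fun x : Kˣ => χ (((g ^ t : Kˣ) : K) * (x : K) ^ ℓ)]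
    refine Finset.sum_congr rfl fun x _ => ?_
    simp only [Equiv.coe_mulLeft, Units.val_mul, Units.val_pow_eq_pow_val]
    rw [pow_add, mul_pow, mul_assoc]
  -- For fixed `x` the sum over `a` runs over all nonzero field elements, giving `-1`.
  have htot : ∑ a : Kˣ, ∑ x : Kˣ, χ ((a : K) * (x : K) ^ ℓ) = -(Nat.card Kˣ : ℂ) := by
    have hin : ∀ x : Kˣ, ∑ a : Kˣ, χ ((a : K) * (x : K) ^ ℓ) = -1 := by
      intro x
      have h := AddChar.sum_mulShift ((x : K) ^ ℓ) hχ
      rw [if_neg (pow_ne_zero _ x.ne_zero), sum_eq_zero_add_sum_units, zero_mul,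
        AddChar.map_zero_eq_one, Nat.cast_zero] at h
      exact eq_neg_of_add_eq_zero_right h
    rw [Finset.sum_comm, Finset.sum_congr rfl fun x _ => hin x]
    simp
  rw [sum_eq_sum_range_generator hg, hM, sum_range_mul_of_periodic hper,
    Finset.range_eq_Ico, Finset.sum_eq_sum_Ico_succ_bot hℓ, nsmul_eq_mul] at htot
  have hgen : ∀ t ∈ Finset.Ico (0 + 1) ℓ,
      ∑ x : Kˣ, χ (((g ^ t : Kˣ) : K) * (x : K) ^ ℓ) = E := by
    intro t ht
    rw [Finset.mem_Ico] at ht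
    refine hE _ fun h => ?_
    rw [← pow_mul, ← orderOf_dvd_iff_pow_eq_one, horder] at h
    exact absurd (Nat.le_of_dvd (by lia) ((Nat.mul_dvd_mul_iff_right hMpos).mp h)) (by lia)
  rw [Finset.sum_congr rfl hgen] at htot
  simp only [pow_zero, Units.val_one, one_mul, Finset.sum_const, Nat.card_Ico, nsmul_eq_mul,
    zero_add] at htot
  rw [Nat.cast_sub hℓ, Nat.cast_mul, Nat.cast_one] at htot
  have hM0 : (M : ℂ) ≠ 0 := by exact_mod_cast hMpos.ne'
  refine mul_left_cancel₀ hM0 ?_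
  linear_combination htot

/-! ### Counting trace-zero elements -/

/-- The element `g^(n ℓ)` is the norm of `g`, a scalar, so the summand has period `n` in the
exponent of `g`; coprimality of `n` and `q - 1` then allows `g` to be replaced by `g^(q-1)`. -/
theorem sum_units_pow_eq_nsmul_sum_range {F K : Type*} [Field F] [Finite F] [Field K] [Finite K]
    [Fintype Kˣ] [Algebra F K] {g : Kˣ} (hg : ∀ x, x ∈ Subgroup.zpowers g) {n ℓ : ℕ} (hn : 0 < n)
    (hv : ∑ i ∈ Finset.range (Module.finrank F K), Nat.card F ^ i = n * ℓ)
    (hcard : Nat.card Kˣ = n * ((Nat.card F - 1) * ℓ)) (hcop : n.Coprime (Nat.card F - 1))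
    {M : Type*} [AddCommMonoid M] {h : Kˣ → M}
    (hh : ∀ (c : Fˣ) (y : Kˣ), h (Units.map (algebraMap F K).toMonoidHom c * y) = h y) :
    ∑ x : Kˣ, h (x ^ ℓ) =
      ((Nat.card F - 1) * ℓ) • ∑ t ∈ Finset.range n, h ((g ^ (Nat.card F - 1)) ^ (ℓ * t)) := by
  have hnorm : g ^ (n * ℓ) =
      Units.map (algebraMap F K).toMonoidHom (Units.map (Algebra.norm F (S := K)) g) := by
    ext
    simp [FiniteField.algebraMap_norm_eq_pow_sum, hv]
  have hper : Function.Periodic (fun t => h ((g ^ t) ^ ℓ)) n := by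
    intro t
    beta_reduce
    rw [pow_add, mul_pow, ← pow_mul g n, hnorm, mul_comm, hh]
  rw [sum_eq_sum_range_generator hg, hcard, sum_range_mul_of_periodic hper,
    ← sum_range_coprime_mul_of_periodic hn hper hcop]
  congr 1
  refine Finset.sum_congr rfl fun t _ => ?_
  rw [pow_mul, ← pow_mul _ t, mul_comm t]

theorem intersectionNumber_eq_sum {F K : Type*} [Field F] [Field K] [Algebra F K] [DecidableEq F]
    (g : Kˣ) (n ℓ i : ℕ) :
    intersectionNumber F g n ℓ i = ∑ t ∈ Finset.range n,
      if Algebra.trace F K (((g ^ (Nat.card F - 1)) ^ i * (g ^ (Nat.card F - 1)) ^ (ℓ * t) : Kˣ) : K)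
        = 0 then 1 else 0 := by
  rw [intersectionNumber, baseBlock, Finset.card_filter]
  refine Finset.sum_congr rfl fun t _ => ?_
  congr 2
  rw [← pow_add, add_comm]
  simp

theorem sum_addChar_smul {F K : Type*} [Field F] [Fintype F] [DecidableEq F] [Field K] [Algebra F K]
    {ψ : AddChar F ℂ} {χ : AddChar K ℂ} (hψ : ψ.IsPrimitive)
    (hχψ : ∀ x, χ x = ψ (Algebra.trace F K x)) (y : K) :
    ∑ c : F, χ (c • y) = if Algebra.trace F K y = 0 then (Fintype.card F : ℂ) else 0 := by
  have h := AddChar.sum_mulShift (Algebra.trace F K y) hψ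
  simp only [hχψ, map_smul, smul_eq_mul, h]
  split_ifs <;> simp

/-- The number of trace-zero elements in a coset of the `ℓ`-th powers, through a power sum. -/
theorem card_mul_sum_trace_eq_zero {F K : Type*} [Field F] [Fintype F] [DecidableEq F] [Field K]
    [Fintype Kˣ] [Algebra F K] {ψ : AddChar F ℂ} {χ : AddChar K ℂ} (hψ : ψ.IsPrimitive)
    (hχψ : ∀ x, χ x = ψ (Algebra.trace F K x)) {ℓ : ℕ} (hcop : (Nat.card Fˣ).Coprime ℓ) (a : K) :
    (Fintype.card F : ℂ) *
        ∑ x : Kˣ, (if Algebra.trace F K (a * (x : K) ^ ℓ) = 0 then 1 else 0 : ℂ) =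
      Nat.card Kˣ + Nat.card Fˣ * ∑ x : Kˣ, χ (a * (x : K) ^ ℓ) := by
  classical
  have hunit : ∀ c : Fˣ, ∑ x : Kˣ, χ ((c : F) • (a * (x : K) ^ ℓ)) =
      ∑ x : Kˣ, χ (a * (x : K) ^ ℓ) := by
    intro c
    obtain ⟨d, rfl⟩ := (powCoprime hcop).surjective c
    rw [← Equiv.sum_comp (Equiv.mulLeft (Units.map (algebraMap F K).toMonoidHom d))
      fun x : Kˣ => χ (a * (x : K) ^ ℓ)]
    refine Finset.sum_congr rfl fun x _ => congrArg χ ?_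
    simp [Algebra.smul_def, mul_pow]
    ring
  calc _ = ∑ x : Kˣ, ∑ c : F, χ (c • (a * (x : K) ^ ℓ)) := by
        rw [Finset.mul_sum]
        refine Finset.sum_congr rfl fun x _ => ?_
        rw [sum_addChar_smul hψ hχψ]
        simp
    _ = ∑ x : Kˣ, χ ((0 : F) • (a * (x : K) ^ ℓ)) +
          ∑ c : Fˣ, ∑ x : Kˣ, χ ((c : F) • (a * (x : K) ^ ℓ)) := by
        rw [Finset.sum_comm, sum_eq_zero_add_sum_units]
    _ = _ := by
        rw [Finset.sum_congr rfl fun c _ => hunit c]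
        simp [AddChar.map_zero_eq_one]

theorem intersectionNumber_eq {F K : Type*} [Field F] [Finite F] [Field K] [Finite K]
    [Fintype Kˣ] [Algebra F K] {g : Kˣ} (hg : ∀ x, x ∈ Subgroup.zpowers g) {n ℓ : ℕ} (hn : 0 < n)
    (hℓ : 0 < ℓ) (hv : ∑ i ∈ Finset.range (Module.finrank F K), Nat.card F ^ i = n * ℓ)
    (hcard : Nat.card Kˣ = n * ((Nat.card F - 1) * ℓ))
    (hcopn : n.Coprime (Nat.card F - 1)) (hcopℓ : (Nat.card F - 1).Coprime ℓ)
    {ψ : AddChar F ℂ} {χ : AddChar K ℂ} (hψ : ψ.IsPrimitive)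
    (hχψ : ∀ x, χ x = ψ (Algebra.trace F K x)) (i : ℕ) :
    (intersectionNumber F g n ℓ i : ℂ) =
      (((Nat.card K : ℂ) - 1) + ((Nat.card F : ℂ) - 1) *
        ∑ x : Kˣ, χ ((((g ^ (Nat.card F - 1)) ^ i : Kˣ) : K) * (x : K) ^ ℓ)) /
        (ℓ * ((Nat.card F : ℂ) - 1) * Nat.card F) := by
  classical
  have := Fintype.ofFinite F
  have hF1 : 1 < Nat.card F := Finite.one_lt_card
  have hFu : Nat.card Fˣ = Nat.card F - 1 := Nat.card_units F
  have hKu : Nat.card Kˣ = Nat.card K - 1 := Nat.card_units K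
  have h1 := sum_units_pow_eq_nsmul_sum_range (F := F) hg hn hv hcard hcopn
    (h := fun y : Kˣ => if Algebra.trace F K (((g ^ (Nat.card F - 1)) ^ i * y : Kˣ) : K) = 0
      then (1 : ℕ) else 0) (by
        intro c y
        have : (((g ^ (Nat.card F - 1)) ^ i *
            (Units.map (algebraMap F K).toMonoidHom c * y) : Kˣ) : K) =
            (c : F) • (((g ^ (Nat.card F - 1)) ^ i * y : Kˣ) : K) := by
          simp [Algebra.smul_def]
          ring
        simp only [this, map_smul, smul_eq_mul, mul_eq_zero, c.ne_zero, false_or])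
  rw [← intersectionNumber_eq_sum, smul_eq_mul] at h1
  have h2 := card_mul_sum_trace_eq_zero hψ hχψ (ℓ := ℓ)
    (by rw [hFu]; exact hcopℓ) (((g ^ (Nat.card F - 1)) ^ i : Kˣ) : K)
  have h3 := congrArg (Nat.cast (R := ℂ)) h1
  simp only [Units.val_mul, Units.val_pow_eq_pow_val, Nat.cast_sum, Nat.cast_mul, Nat.cast_ite,
    Nat.cast_one, Nat.cast_zero] at h2 h3 ⊢
  rw [h3, hFu, hKu, Nat.cast_sub hF1.le, Nat.cast_sub Finite.card_pos, Nat.cast_one,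
    ← Nat.card_eq_fintype_card] at h2
  have hq0 : (Nat.card F : ℂ) ≠ 0 := by exact_mod_cast (by lia : Nat.card F ≠ 0)
  have hq1 : (Nat.card F : ℂ) - 1 ≠ 0 := sub_ne_zero.mpr (by exact_mod_cast hF1.ne')
  have hℓ0 : (ℓ : ℂ) ≠ 0 := by exact_mod_cast hℓ.ne'
  rw [eq_div_iff (mul_ne_zero (mul_ne_zero hℓ0 hq1) hq0), ← h2]
  ring

/-! ### The main theorem -/

theorem coprime_sub_one_of_geom_sum_eq {q m N : ℕ} (hq : 1 ≤ q) (hgcd : Nat.gcd (q - 1) m = 1)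
    (hN : ∑ i ∈ Finset.range m, q ^ i = N) : (q - 1).Coprime N := by
  have h : N ≡ m [MOD (q - 1)] := by
    have hq1 : q ≡ 1 [MOD (q - 1)] := ((Nat.modEq_iff_dvd' hq).mpr dvd_rfl).symm
    have : ∀ m, ∑ i ∈ Finset.range m, q ^ i ≡ m [MOD (q - 1)] := by
      intro m
      induction m with
      | zero => rfl
      | succ m ih =>
        rw [Finset.sum_range_succ]
        exact ih.add (by simpa using hq1.pow m)
    exact hN ▸ this m
  rw [Nat.Coprime, Nat.gcd_comm, h.gcd_eq, Nat.gcd_comm, hgcd]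

theorem mainTheorem9 {F K : Type*} [Field F] [Finite F] [Field K] [Finite K] [Algebra F K]
    (p q m r j γ ℓ n : ℕ) (hp : p.Prime)
    (hq : Nat.card F = q) (hm : Module.finrank F K = m)
    (hgcd : Nat.gcd (q - 1) m = 1)
    (g : Kˣ) (hg : ∀ x : Kˣ, x ∈ Subgroup.zpowers g)
    (hv : (q ^ m - 1) / (q - 1) = n * ℓ) (hn : 1 < n) (hℓ : 2 ≤ ℓ)
    (hrq : r = q ^ m) (hγ : 0 < γ) (hrp : r = p ^ (2 * j * γ))
    (hj : IsLeast {t : ℕ | 0 < t ∧ ℓ ∣ p ^ t + 1} j) :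
    ((Odd γ ∧ Odd p ∧ Odd ((p ^ j + 1) / ℓ)) →
      (∃! i : ℕ, i < ℓ ∧ i * (q - 1) ≡ ℓ / 2 [MOD ℓ]) ∧
      (∀ i : ℕ, i < ℓ → i * (q - 1) ≡ ℓ / 2 [MOD ℓ] →
        (intersectionNumber F g n ℓ i : ℝ) =
          ((r : ℝ) - 1 + (((ℓ : ℝ) - 1) * √(r : ℝ) - 1) * ((q : ℝ) - 1)) /
            ((ℓ : ℝ) * ((q : ℝ) - 1) * (q : ℝ))) ∧
      (∀ i : ℕ, i < ℓ → ¬ i * (q - 1) ≡ ℓ / 2 [MOD ℓ] →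
        (intersectionNumber F g n ℓ i : ℝ) =
          (((r : ℝ) - 1) - (1 + √(r : ℝ)) * ((q : ℝ) - 1)) /
            ((ℓ : ℝ) * ((q : ℝ) - 1) * (q : ℝ)))) ∧
    (¬ (Odd γ ∧ Odd p ∧ Odd ((p ^ j + 1) / ℓ)) →
      (intersectionNumber F g n ℓ 0 : ℝ) =
        ((r : ℝ) - 1 - ((q : ℝ) - 1) * ((-1) ^ γ * ((ℓ : ℝ) - 1) * √(r : ℝ) + 1)) /
          ((ℓ : ℝ) * ((q : ℝ) - 1) * (q : ℝ)) ∧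
      (∀ i : ℕ, 0 < i → i < ℓ →
        (intersectionNumber F g n ℓ i : ℝ) =
          ((r : ℝ) - 1 + ((q : ℝ) - 1) * ((-1) ^ γ * √(r : ℝ) - 1)) /
            ((ℓ : ℝ) * ((q : ℝ) - 1) * (q : ℝ)))) := by
  have := Fintype.ofFinite K
  have := Fintype.ofFinite Kˣ
  have : Fact p.Prime := ⟨hp⟩
  obtain ⟨⟨hj0, k, hk⟩, -⟩ := hj
  have hq2 : 2 ≤ q := hq ▸ Finite.one_lt_card
  have hm0 : m ≠ 0 := hm ▸ (Module.finrank_pos (R := F) (M := K)).ne'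
  have hKr : Nat.card K = r := by rw [Module.natCard_eq_pow_finrank (K := F), hq, hm, hrq]
  obtain ⟨e, he⟩ : ∃ e, q = p ^ e := by
    have : q ∣ p ^ (2 * j * γ) := hrp ▸ hrq ▸ dvd_pow_self q hm0
    obtain ⟨e, -, h⟩ := (Nat.dvd_prime_pow hp).mp this
    exact ⟨e, h⟩
  have he0 : e ≠ 0 := by
    rintro rfl
    simp at he
    lia
  have : CharP F p := by
    have := Fintype.ofFinite F
    exact charP_of_card_eq_prime_pow (f := e) (by rw [← Nat.card_eq_fintype_card, hq, he])
  have : CharP K p := charP_of_injective_algebraMap' F p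
  have hgeom : ∑ i ∈ Finset.range m, q ^ i = n * ℓ := by rw [Nat.geomSum_eq hq2, hv]
  have hcop := coprime_sub_one_of_geom_sum_eq (by lia) hgcd hgeom
  have hcopn : (q - 1).Coprime n := hcop.coprime_dvd_right (dvd_mul_right n ℓ)
  have hcopℓ : (q - 1).Coprime ℓ := hcop.coprime_dvd_right (dvd_mul_left ℓ n)
  -- An even `ℓ` forces `p`, hence `q`, to be odd, so `2` would divide both `q - 1` and `ℓ`.
  have hodd : Odd ℓ := by
    by_contra hev
    have h2ℓ : 2 ∣ ℓ := (Nat.not_odd_iff_even.mp hev).two_dvd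
    have hpodd : ¬ Even p := by
      intro hpe
      have h1 : 2 ∣ p ^ j + 1 := h2ℓ.trans ⟨k, hk⟩
      have h2 : 2 ∣ p ^ j := hpe.two_dvd.trans (dvd_pow_self p hj0.ne')
      lia
    have hqodd : Odd q := he ▸ (Nat.not_even_iff_odd.mp hpodd).pow
    have : 2 ∣ q - 1 := by
      obtain ⟨t, rfl⟩ := hqodd
      exact ⟨t, by lia⟩
    exact absurd (Nat.dvd_gcd this h2ℓ) (by rw [hcopℓ]; norm_num)
  have hKu : Nat.card Kˣ = n * ((q - 1) * ℓ) := by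
    rw [Nat.card_units, hKr, hrq, ← Nat.div_mul_cancel (by simpa using Nat.sub_dvd_pow_sub_pow q 1 m :
      q - 1 ∣ q ^ m - 1), hv]
    ring
  set M := n * (q - 1) with hMdef
  have hM : Nat.card Kˣ = ℓ * M := by rw [hKu, hMdef]; ring
  have hr : r = (p ^ j) ^ (2 * γ) := by rw [hrp, ← pow_mul]; congr 1; ring
  obtain ⟨c, hc, hkc⟩ : ∃ c, M = (p ^ j - 1) * c ∧ k ∣ c := by
    have h1 : (p ^ j) ^ 2 - 1 ∣ ℓ * M := by
      rw [← hM, Nat.card_units, hKr, hr, pow_mul]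
      simpa using Nat.sub_dvd_pow_sub_pow ((p ^ j) ^ 2) 1 γ
    obtain ⟨d, hd⟩ := h1
    refine ⟨k * d, Nat.eq_of_mul_eq_mul_left (by lia : 0 < ℓ) ?_, dvd_mul_right k d⟩
    rw [hd, show (p ^ j) ^ 2 - 1 = (p ^ j + 1) * (p ^ j - 1) by simpa using Nat.sq_sub_sq (p ^ j) 1,
      hk]
    ring
  have hMpos : 0 < M := Nat.mul_pos (by lia) (by lia)
  obtain ⟨ψ, χ, hψ, hχ, hfr, hχψ⟩ := exists_primitive_addChar_trace F K p
  have hgen := fun (a : Kˣ) (ha : a ^ M ≠ 1) => sum_units_pow_of_not_pow p hχ hfr hj0 hodd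
    (hKr.trans hr) hk hM hc hkc ha
  have hone := sum_units_pow_one hχ hg (by lia) hM hgen
  have hcount := intersectionNumber_eq hg (n := n) (ℓ := ℓ) (by lia) (by lia)
    (by rw [hq, hm, hgeom]) (by rw [hKu, hq]) (by rw [hq]; exact hcopn.symm) (by rw [hq]; exact hcopℓ)
    hψ hχψ
  rw [hq, hKr] at hcount
  have hsqrt : √(r : ℝ) = ((p : ℝ) ^ j) ^ γ := by
    rw [hr, Real.sqrt_eq_iff_eq_sq (by positivity) (by positivity)]
    push_cast
    ring
  refine ⟨fun ⟨_, hpodd, hkodd⟩ => ?_, fun _ => ⟨?_, fun i hi0 hiℓ => ?_⟩⟩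
  -- Case A is vacuous: `p^j + 1 = ℓ k` would be odd with `p` odd.
  · rw [hk, Nat.mul_div_cancel_left _ (by lia)] at hkodd
    exact absurd (hk ▸ hodd.mul hkodd) (Nat.not_odd_iff_even.mpr hpodd.pow.add_one)
  · have h := hcount 0
    simp only [pow_zero, Units.val_one, one_mul] at h
    rw [hone] at h
    rw [hsqrt]
    apply Complex.ofReal_injective
    push_cast
    rw [h]
    ring
  · have h := hcount i
    rw [hgen] at h
    · rw [hsqrt]
      apply Complex.ofReal_injective
      push_cast
      rw [h]
    -- If `α^i` were an `ℓ`-th power, then `ℓ ∣ (q - 1) i`, hence `ℓ ∣ i`, against `0 < i < ℓ`.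
    · intro h1
      rw [← pow_mul, ← pow_mul, ← orderOf_dvd_iff_pow_eq_one,
        orderOf_eq_card_of_forall_mem_zpowers hg, hM, ← mul_assoc (q - 1) i M,
        Nat.mul_dvd_mul_iff_right hMpos] at h1
      exact absurd (Nat.le_of_dvd hi0 (hcopℓ.symm.dvd_of_dvd_mul_left h1)) (by lia)
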